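/- Let $q$ be a prime power, $n\ge 1$ an integer with $q\equiv 1 \pmod n$ if $n$ is odd and $q\equiv 1\pmod{2n}$ if $n$ is even. For $r\geq 1$ let $\Gamma_r=\operatorname{Hom}(\mathbb{F}_{q^r}^\times,\mathbb{C}^\times)$, and regard $\Gamma_1$ as a subgroup of $\Gamma_r$ through composition with the norm $\mathbb{F}_{q^r}^\times\to\mathbb{F}_q^\times$. Fix a generator $\delta$ of $\Gamma_1$ and an element $\zeta_n\in\mathbb{F}_q^\times$ of order $n$. Let $D,\hat d,t$ be divisors of $n$ with $D\mid t\hat d$ and $\hat d\mid D$, and let $\vec\lambda=(\lambda_1,\dots,\lambda_m)$ be positive integers with $n=\hat d\,t\sum_{i=1}^m\lambda_i$. Put $s=(q-1)/t$ and $\hat t=t\hat d/D$. For a class $[\alpha]\in\Gamma_D/\langle\delta^s\rangle$ write $\{[\alpha]\}=\{[\alpha]^{q^i}: i\ge 0\}$ for its Frobenius orbit and $\deg([\alpha])$ for the size of this orbit (the newdegree of $\alpha$). Evaluation $\alpha\mapsto\alpha(\zeta_n^{\hat t})$ on $\Gamma_D$ is well defined on $\Gamma_D/\langle\delta^s\rangle$;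 set $$\widehat Z(D,t,\hat d,\vec\lambda)=\sum_{\substack{([\alpha_1],\dots,[\alpha_m])\in(\Gamma_D/\langle\delta^s\rangle)^m\\ \{[\alpha_i]\}\ne\{[\alpha_j]\}\ (i\neq j)\\ \deg([\alpha_i])=\hat d\ (1\le i\le m)}}\ \prod_{i=1}^m\alpha_i^{\lambda_i}(\zeta_n^{\hat t}).$$ Then $$\widehat Z(D,t,\hat d,\vec\lambda)=\begin{cases}\mu(\hat d)\,(-\hat d)^{m-1}\,(m-1)!\,\dfrac{q-1}{t} & \text{if }\gcd(D,t)=1,\\[1ex] 0&\text{otherwise,}\end{cases}$$ where $\mu$ is the Möbius function. -/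

import Mathlib

namespace NewDegree

/-- The complex character group of the multiplicative group of a field `k`. For `k` the field
with `q ^ r` elements this is `Γ_r`. -/
def CharGroup (k : Type*) [Field k] : Type _ := kˣ →* ℂˣ

/-- The group structure on characters is pointwise multiplication. -/
noncomputable instance (k : Type*) [Field k] : CommGroup (CharGroup k) :=
  inferInstanceAs (CommGroup (kˣ →* ℂˣ))

instance (k : Type*) [Field k] : FunLike (CharGroup k) kˣ ℂˣ :=
  inferInstanceAs (FunLike (kˣ →* ℂˣ) kˣ ℂˣ)

instance (k : Type*) [Field k] : MonoidHomClass (CharGroup k) kˣ ℂˣ :=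
  inferInstanceAs (MonoidHomClass (kˣ →* ℂˣ) kˣ ℂˣ)

instance (k : Type*) [Field k] [Finite k] : Finite (CharGroup k) :=
  inferInstanceAs (Finite (kˣ →* ℂˣ))

theorem CharGroup.mul_apply {k : Type*} [Field k] (α β : CharGroup k) (x : kˣ) :
    (α * β) x = α x * β x := rfl

/-- Evaluation of characters at a fixed element. -/
noncomputable def CharGroup.eval {k : Type*} [Field k] (x : kˣ) : CharGroup k →* ℂˣ where
  toFun α := α x
  map_one' := rfl
  map_mul' _ _ := rfl

/-- The norm map on unit groups of a field extension. -/
noncomputable def unitNorm (F K : Type*) [Field F] [Field K] [Algebra F K] : Kˣ →* Fˣ :=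
  Units.map (Algebra.norm F)

/-- The transpose of the norm, the inclusion of `Γ_1` in `Γ_D`. -/
noncomputable def normTranspose (F K : Type*) [Field F] [Field K] [Algebra F K] :
    CharGroup F →* CharGroup K where
  toFun β := MonoidHom.comp (β : Fˣ →* ℂˣ) (unitNorm F K)
  map_one' := rfl
  map_mul' _ _ := rfl

/-- The quotient of the characters of `Kˣ` by the cyclic subgroup generated by `δ ^ s`, where
`s = (q - 1) / t`, `q` is the cardinality of `F`, and `δ` is regarded as a character of `Kˣ`. -/
abbrev CharClass {F : Type*} (K : Type*) [Field F] [Field K] [Algebra F K]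
    (δ : CharGroup F) (t : ℕ) : Type _ :=
  CharGroup K ⧸ Subgroup.zpowers (normTranspose F K (δ ^ ((Nat.card F - 1) / t)))

/-- The orbit of an element of a commutative group under the Frobenius action `c ↦ c ^ q`. -/
def frobOrbit {G : Type*} [CommGroup G] (q : ℕ) (c : G) : Set G :=
  Set.range fun i : ℕ => c ^ q ^ i

/-- The degree of an element: the size of its Frobenius orbit. The degree of the class of a
character in `CharClass` is the newdegree of the character. -/
noncomputable def frobDegree {G : Type*} [CommGroup G] (q : ℕ) (c : G) : ℕ :=
  (frobOrbit q c).ncard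

/-- The element `ζ ^ (t d̂ / D)` of `Kˣ`, for `ζ` in `Fˣ`, where `D` is the degree of `K` over
`F`. -/
noncomputable def evalPoint {F : Type*} (K : Type*) [Field F] [Field K] [Algebra F K]
    (ζ : Fˣ) (t dhat : ℕ) : Kˣ :=
  Units.map (algebraMap F K : F →* K) ζ ^ (t * dhat / Module.finrank F K)

section

variable {F K : Type*} [Field F] [Field K] [Algebra F K]
  {δ : CharGroup F} {ζ : Fˣ} {n D t dhat : ℕ}

/-- The character `δ ^ s` of `Kˣ` is trivial at `ζ ^ (t d̂ / D)`. -/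
theorem normTranspose_evalPoint (hζ : orderOf ζ = n) (hD : Module.finrank F K = D)
    (ht : t ∣ n) (hDt : D ∣ t * dhat) :
    normTranspose F K (δ ^ ((Nat.card F - 1) / t)) (evalPoint K ζ t dhat) = 1 := by
  have hcard : Nat.card Fˣ = Nat.card F - 1 := Nat.card_units F
  have htq : t ∣ Nat.card F - 1 := by
    rw [← hcard]
    exact ht.trans (hζ ▸ orderOf_dvd_natCard ζ)
  have hnorm : unitNorm F K (Units.map (algebraMap F K : F →* K) ζ) = ζ ^ D := by
    ext
    simp [unitNorm, Algebra.norm_algebraMap, hD]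
  have h1 : ζ ^ (Nat.card F - 1) = 1 := by rw [← hcard]; exact pow_card_eq_one'
  have hpow (k : ℕ) (y : Fˣ) : (δ ^ k) y = δ y ^ k := map_pow (CharGroup.eval y) δ k
  obtain ⟨u, hu⟩ := hDt
  obtain ⟨s, hs⟩ := htq
  have hmul : D * (t * dhat / D) = t * dhat := Nat.mul_div_cancel' ⟨u, hu⟩
  change (δ ^ ((Nat.card F - 1) / t)) (unitNorm F K (evalPoint K ζ t dhat)) = 1
  rw [evalPoint, map_pow, hnorm, hD, ← pow_mul, hmul, hpow, ← map_pow,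
    ← pow_mul]
  have h2 : t * dhat * ((Nat.card F - 1) / t) = (Nat.card F - 1) * dhat := by
    rw [mul_right_comm, Nat.mul_div_cancel' ⟨s, hs⟩]
  rw [h2, pow_mul, h1, one_pow, map_one]

/-- Evaluation of a class of characters of `Kˣ` at `ζ ^ (t d̂ / D)`, computed on any
representative. -/
noncomputable def evalClass (δ : CharGroup F) (hζ : orderOf ζ = n)
    (hD : Module.finrank F K = D) (ht : t ∣ n) (hDt : D ∣ t * dhat) :
    CharClass K δ t →* ℂˣ :=
  QuotientGroup.lift _ (CharGroup.eval (evalPoint K ζ t dhat)) <| by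
    rw [Subgroup.zpowers_le]
    exact normTranspose_evalPoint hζ hD ht hDt

theorem evalClass_mk (hζ : orderOf ζ = n) (hD : Module.finrank F K = D) (ht : t ∣ n)
    (hDt : D ∣ t * dhat) (α : CharGroup K) :
    evalClass δ hζ hD ht hDt (QuotientGroup.mk α) = α (evalPoint K ζ t dhat) :=
  rfl

end

open scoped Classical in
/-- The sum, over the `m`-tuples of classes of characters of `Kˣ` modulo `δ ^ s` which all have
newdegree `d̂` and have pairwise distinct Frobenius orbits, of the products of the
`α_i ^ λ_i (ζ ^ (t d̂ / D))`. -/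
noncomputable def Zhat {F K : Type*} [Field F] [Field K] [Finite K] [Algebra F K]
    {ζ : Fˣ} {n D t dhat : ℕ} (δ : CharGroup F) (hζ : orderOf ζ = n)
    (hD : Module.finrank F K = D) (ht : t ∣ n) (hDt : D ∣ t * dhat)
    {m : ℕ} (lam : Fin m → ℕ) : ℂ :=
  letI : Fintype (CharClass K δ t) := Fintype.ofFinite _
  ∑ c : Fin m → CharClass K δ t with
      (∀ i j, i ≠ j → frobOrbit (Nat.card F) (c i) ≠ frobOrbit (Nat.card F) (c j)) ∧
      (∀ i, frobDegree (Nat.card F) (c i) = dhat),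
    ∏ i, ((evalClass δ hζ hD ht hDt (c i) : ℂˣ) : ℂ) ^ lam i

end NewDegree

/-! ### Sums over tuples with distinct fibres -/

section

open Finset

/-! Evaluation is constant on Frobenius orbits, and the admissible orbits all have size d̂. Removing
one entry of a tuple by inclusion-exclusion (`distinctFiberSum_succ`) therefore leaves only power
sums p_k of the evaluation over classes of degree d̂. If p_k = 0 for 0 < k < L = ∑ λ_i, the
recursion collapses to (-d̂)^(m-1) (m-1)! p_L.

The power sums come from `sum_frobDegree_pow`. Möbius inversion over the degree reduces p_k to
character sums over the subgroups c^(q^e-1) = 1 of a cyclic group of order N = (q^D-1)/t, where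
evaluation sends a generator to a root of unity of order DL. Such a sum is nonzero only if DL
divides k N / gcd(N, q^e-1). The congruence on q makes (q^D-1)/(q-1) equal to D times a unit modulo
n. For 0 < k ≤ L this forces k = L and gcd(D,t) = 1, and then D = d̂ and only e = 1 contributes. -/

/-- Tuples of elements of `s` lying in pairwise distinct fibres of `o`. -/
def DistinctFibers {ι α β : Type*} (o : α → β) (s : Finset α) (c : ι → α) : Prop :=
  (∀ i j, i ≠ j → o (c i) ≠ o (c j)) ∧ ∀ i, c i ∈ s

theorem distinctFibers_cons {α β : Type*} (o : α → β) (s : Finset α) {m : ℕ} (x : α)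
    (c : Fin m → α) :
    DistinctFibers o s (Fin.cons x c : Fin (m + 1) → α) ↔
      DistinctFibers o s c ∧ x ∈ s ∧ ∀ i, o x ≠ o (c i) := by
  simp only [DistinctFibers, Fin.forall_fin_succ, Fin.cons_zero, Fin.cons_succ]
  constructor
  · rintro ⟨⟨⟨-, h1⟩, h2⟩, h3, h4⟩
    exact ⟨⟨fun i j hij => (h2 i).2 j (by simpa using hij), h4⟩, h3,
      fun i => h1 i (Fin.succ_ne_zero i).symm⟩
  · rintro ⟨⟨h1, h2⟩, h3, h4⟩
    exact ⟨⟨⟨fun h => absurd rfl h, fun i _ => h4 i⟩, fun i => ⟨fun _ => (h4 i).symm,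
      fun j hij => h1 i j (by simpa using hij)⟩⟩, h3, h2⟩

open scoped Classical in
/-- The sum of the products of powers of the values of `f`, over tuples with distinct fibres. -/
noncomputable def distinctFiberSum {α β R : Type*} [Fintype α] [CommRing R] (o : α → β)
    (s : Finset α) (f : α → R) {m : ℕ} (lam : Fin m → ℕ) : R :=
  ∑ c : Fin m → α with DistinctFibers o s c, ∏ i, f (c i) ^ lam i

section

variable {α β R : Type*} [CommRing R] {o : α → β} {s : Finset α} {f : α → R} {d : ℕ}

open scoped Classical in
theorem sum_avoiding_fibers (hd : ∀ x ∈ s, #{y ∈ s | o y = o x} = d)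
    (hf : ∀ x ∈ s, ∀ y ∈ s, o x = o y → f x = f y) {m : ℕ} {c : Fin m → α}
    (hc : DistinctFibers o s c) (k : ℕ) :
    ∑ x ∈ s with ∀ i, o x ≠ o (c i), f x ^ k =
      ∑ x ∈ s, f x ^ k - ∑ i, (d : R) * f (c i) ^ k := by
  have h1 : ∀ i, ∑ x ∈ s with o x = o (c i), f x ^ k = (d : R) * f (c i) ^ k := by
    intro i
    rw [← hd (c i) (hc.2 i), ← nsmul_eq_mul, ← Finset.sum_const]
    refine Finset.sum_congr rfl fun x hx => ?_
    rw [mem_filter] at hx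
    rw [hf x hx.1 _ (hc.2 i) hx.2]
  have h2 : ∑ x ∈ s with ¬ ∀ i, o x ≠ o (c i), f x ^ k = ∑ i, (d : R) * f (c i) ^ k := by
    rw [← Finset.sum_congr rfl fun i _ => h1 i, ← Finset.sum_biUnion]
    · refine Finset.sum_congr ?_ fun _ _ => rfl
      ext x
      simp
    · intro i _ j _ hij
      rw [Function.onFun, Finset.disjoint_left]
      intro x hx hx'
      rw [mem_filter] at hx hx'
      exact hc.1 i j hij (hx.2.symm.trans hx'.2)
  rw [← h2, eq_sub_iff_add_eq, Finset.sum_filter_add_sum_filter_not]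

variable [Fintype α]

-- Let the first entry range over all of `s`, then subtract the cases where it falls into the fibre
-- of another entry. In each such case its exponent merges with that entry's, with multiplicity `d`.
open scoped Classical in
theorem distinctFiberSum_succ (hd : ∀ x ∈ s, #{y ∈ s | o y = o x} = d)
    (hf : ∀ x ∈ s, ∀ y ∈ s, o x = o y → f x = f y) {m : ℕ} (lam : Fin (m + 1) → ℕ) :
    distinctFiberSum o s f lam =
      (∑ x ∈ s, f x ^ lam 0) * distinctFiberSum o s f (fun i : Fin m => lam i.succ) -
        d * ∑ i, distinctFiberSum o s f (fun j => lam j.succ + (Pi.single i (lam 0) : Fin m → ℕ) j) := by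
  have h1 : distinctFiberSum o s f lam = ∑ c : Fin m → α with DistinctFibers o s c,
      (∏ i, f (c i) ^ lam i.succ) * ∑ x ∈ s with ∀ i, o x ≠ o (c i), f x ^ lam 0 := by
    rw [distinctFiberSum, Finset.sum_filter,
      ← Equiv.sum_comp (Fin.consEquiv fun _ : Fin (m + 1) => α), Fintype.sum_prod_type_right,
      Finset.sum_filter]
    refine Finset.sum_congr rfl fun c _ => ?_
    have e : ∀ x : α, (Fin.consEquiv fun _ : Fin (m + 1) => α) (x, c) = Fin.cons x c :=
      fun _ => rfl
    simp only [e, distinctFibers_cons, Fin.prod_univ_succ, Fin.cons_zero, Fin.cons_succ]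
    split_ifs with h
    · simp only [h, true_and, Finset.mul_sum]
      rw [← Finset.sum_filter, ← Finset.filter_filter, Finset.filter_univ_mem]
      exact Finset.sum_congr rfl fun x _ => mul_comm _ _
    · simp [h]
  have h2 : ∀ (i : Fin m) (c : Fin m → α),
      ∏ j, f (c j) ^ (lam j.succ + (Pi.single i (lam 0) : Fin m → ℕ) j) =
        (∏ j, f (c j) ^ lam j.succ) * f (c i) ^ lam 0 := by
    intro i c
    simp only [pow_add, Finset.prod_mul_distrib]
    congr 1
    rw [Finset.prod_eq_single i]
    · simp
    · intro j _ hj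
      simp [Pi.single_eq_of_ne hj]
    · simp
  rw [h1]
  simp only [distinctFiberSum, h2]
  rw [Finset.sum_comm, Finset.mul_sum, Finset.mul_sum, ← Finset.sum_sub_distrib]
  refine Finset.sum_congr rfl fun c hc => ?_
  rw [sum_avoiding_fibers hd hf (mem_filter.1 hc).2, ← Finset.mul_sum, ← Finset.mul_sum]
  ring

open scoped Classical in
theorem distinctFiberSum_eq_of_powerSum_eq_zero (hd : ∀ x ∈ s, #{y ∈ s | o y = o x} = d)
    (hf : ∀ x ∈ s, ∀ y ∈ s, o x = o y → f x = f y) {m : ℕ} (lam : Fin (m + 1) → ℕ)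
    (hlam : ∀ i, 0 < lam i)
    (hp : ∀ k, 0 < k → k < ∑ i, lam i → ∑ x ∈ s, f x ^ k = 0) :
    distinctFiberSum o s f lam =
      (-(d : R)) ^ m * (m.factorial : R) * ∑ x ∈ s, f x ^ ∑ i, lam i := by
  induction m with
  | zero =>
    rw [distinctFiberSum_succ hd hf]
    simp [distinctFiberSum, DistinctFibers]
  | succ m ih =>
    have hsum : ∀ i : Fin (m + 1),
        ∑ j, (lam j.succ + (Pi.single i (lam 0) : Fin (m + 1) → ℕ) j) = ∑ j, lam j := by
      intro i
      rw [Fin.sum_univ_succ lam]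
      simp only [Finset.sum_add_distrib]
      rw [Finset.sum_pi_single' i (lam 0) univ]
      simp [add_comm]
    have hlt : lam 0 < ∑ i, lam i := by
      rw [Fin.sum_univ_succ, Fin.sum_univ_succ]
      have := hlam (Fin.succ 0)
      omega
    -- At least two exponents remain, so the product term dies. Each of the `m + 1` merged sums has
    -- the same total exponent, and hence the same value by induction.
    rw [distinctFiberSum_succ hd hf, hp _ (hlam 0) hlt]
    have h3 : ∀ i : Fin (m + 1), distinctFiberSum o s f
        (fun j => lam j.succ + (Pi.single i (lam 0) : Fin (m + 1) → ℕ) j) =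
          (-(d : R)) ^ m * (m.factorial : R) * ∑ x ∈ s, f x ^ ∑ i, lam i := by
      intro i
      rw [ih, hsum]
      · intro j
        have := hlam j.succ
        omega
      · rw [hsum]
        exact hp
    simp only [h3, Finset.sum_const, card_univ, Fintype.card_fin, nsmul_eq_mul,
      Nat.factorial_succ]
    push_cast
    ring

end

/-! ### Arithmetic of the geometric sum -/

/-- The difference is `q - 1` times a double sum congruent to D(D-1)/2 modulo `D`. For odd `n` this
is 0 modulo `D`; for even `n` the missing factor 2 is supplied by 2n ∣ q - 1. -/
theorem geom_sum_modEq {q n D : ℕ} (hD : 0 < D) (hDn : D ∣ n)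
    (hqodd : Odd n → q ≡ 1 [MOD n]) (hqeven : Even n → q ≡ 1 [MOD 2 * n]) :
    ((D * n : ℕ) : ℤ) ∣ ∑ i ∈ range D, (q : ℤ) ^ i - D := by
  have hS : ∑ i ∈ range D, (q : ℤ) ^ i - D =
      (∑ i ∈ range D, ∑ j ∈ range i, (q : ℤ) ^ j) * (q - 1) := by
    rw [Finset.sum_mul, Finset.sum_congr rfl fun i _ => geom_sum_mul (q : ℤ) i]
    simp
  have hqn : (n : ℤ) ∣ q - 1 := by
    rcases Nat.even_or_odd n with h | h
    · have := (hqeven h).symm.dvd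
      push_cast at this
      exact (Dvd.intro_left _ rfl).trans this
    · simpa using (hqodd h).symm.dvd
  have hqD : (q : ℤ) ≡ 1 [ZMOD D] :=
    (Int.modEq_iff_dvd.2 ((Int.natCast_dvd_natCast.2 hDn).trans hqn)).symm
  have hT : ∑ i ∈ range D, ∑ j ∈ range i, (q : ℤ) ^ j ≡ ∑ i ∈ range D, (i : ℤ) [ZMOD D] := by
    refine Int.ModEq.sum fun i _ => ?_
    calc ∑ j ∈ range i, (q : ℤ) ^ j ≡ ∑ j ∈ range i, (1 : ℤ) [ZMOD D] := by
          refine Int.ModEq.sum fun j _ => ?_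
          simpa using hqD.pow j
      _ = i := by simp
  have hG : (∑ i ∈ range D, (i : ℤ)) * 2 = D * (D - 1) := by
    have := Finset.sum_range_id_mul_two D
    have h2 := congrArg (Nat.cast : ℕ → ℤ) this
    push_cast [Nat.cast_sub (show 1 ≤ D from hD)] at h2
    exact h2
  rw [hS]
  push_cast
  rcases Nat.even_or_odd n with h | h
  · obtain ⟨a, ha⟩ := (hqeven h).symm.dvd
    push_cast at ha
    rw [ha]
    have h3 : (D : ℤ) ∣ (∑ i ∈ range D, ∑ j ∈ range i, (q : ℤ) ^ j) * 2 := by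
      refine (hT.mul_right 2).dvd_iff.2 ?_
      rw [hG]
      exact dvd_mul_right _ _
    calc (D : ℤ) * n ∣ (∑ i ∈ range D, ∑ j ∈ range i, (q : ℤ) ^ j) * 2 * (n * a) :=
          mul_dvd_mul h3 (dvd_mul_right _ _)
      _ = _ := by ring
  · refine mul_dvd_mul ?_ hqn
    refine hT.dvd_iff.2 ?_
    have hodd : Odd D := Odd.of_dvd_nat h hDn
    have hcop : IsCoprime (D : ℤ) 2 := by
      exact_mod_cast Nat.isCoprime_iff_coprime.2 hodd.coprime_two_right
    refine hcop.dvd_of_dvd_mul_right ?_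
    rw [hG]
    exact dvd_mul_right _ _

/-- The geometric sum is `D` times a unit modulo `n`. -/
theorem exists_geom_sum_eq_mul {q n D : ℕ} (hD : 0 < D) (hDn : D ∣ n)
    (hqodd : Odd n → q ≡ 1 [MOD n]) (hqeven : Even n → q ≡ 1 [MOD 2 * n]) :
    ∃ u : ℕ, ∑ i ∈ range D, q ^ i = D * u ∧ Nat.Coprime u n := by
  obtain ⟨a, ha⟩ := geom_sum_modEq hD hDn hqodd hqeven
  have hDd : D ∣ ∑ i ∈ range D, q ^ i := by
    rw [← Int.natCast_dvd_natCast]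
    push_cast
    refine ⟨1 + n * a, ?_⟩
    push_cast at ha
    linear_combination ha
  obtain ⟨u, hu⟩ := hDd
  refine ⟨u, hu, ?_⟩
  rw [← Nat.isCoprime_iff_coprime]
  refine ⟨1, -a, ?_⟩
  have h2 : ((∑ i ∈ range D, q ^ i : ℕ) : ℤ) = D * u := by rw [hu]; push_cast; ring
  push_cast at h2
  rw [h2] at ha
  have hD0 : (D : ℤ) ≠ 0 := by exact_mod_cast hD.ne'
  apply mul_left_cancel₀ hD0
  push_cast at ha
  linear_combination ha

/-- With q - 1 = ts and q^D - 1 = (q-1)Du, the order (q^D-1)/t is sDu. Since `u` is prime to `n`, it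
drops out of both the gcd and the divisibility. -/
theorem dvd_card_div_gcd_sub_one_iff {q n D t L k : ℕ} (hq : 1 < q) (hD : 0 < D) (hDn : D ∣ n)
    (hqodd : Odd n → q ≡ 1 [MOD n]) (hqeven : Even n → q ≡ 1 [MOD 2 * n])
    (htq : t ∣ q - 1) (htL : t * L ∣ n) (ht : 0 < t) (htn : t ∣ n) :
    (Nat.gcd ((q ^ D - 1) / t) (q - 1) = (q - 1) / t * Nat.gcd D t) ∧
    (D * L ∣ k * (((q ^ D - 1) / t) / Nat.gcd ((q ^ D - 1) / t) (q - 1)) ↔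
      Nat.gcd D t * L ∣ k) := by
  obtain ⟨u, hu, hcop⟩ := exists_geom_sum_eq_mul hD hDn hqodd hqeven
  obtain ⟨s, hs⟩ := htq
  have hqD : q ^ D - 1 = t * (s * (D * u)) := by
    rw [← hu, ← mul_assoc, ← hs, mul_comm, Nat.geomSum_eq hq, Nat.div_mul_cancel]
    simpa using Nat.sub_dvd_pow_sub_pow q 1 D
  have hs0 : 0 < s := Nat.pos_of_ne_zero (by rintro rfl; omega)
  have hgcd : Nat.gcd ((q ^ D - 1) / t) (q - 1) = s * Nat.gcd D t := by
    rw [hqD, Nat.mul_div_cancel_left _ ht, hs, mul_comm t s, Nat.gcd_mul_left]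
    congr 1
    exact Nat.Coprime.gcd_mul_right_cancel _ (hcop.coprime_dvd_right htn)
  have hst : (q - 1) / t = s := by rw [hs, Nat.mul_div_cancel_left _ ht]
  refine ⟨by rw [hgcd, hst], ?_⟩
  rw [hgcd, hqD, Nat.mul_div_cancel_left _ ht, Nat.mul_div_mul_left _ _ hs0]
  set g := Nat.gcd D t with hg
  have hg0 : 0 < g := Nat.gcd_pos_of_pos_left _ hD
  obtain ⟨D', hD'⟩ := Nat.gcd_dvd_left D t
  rw [← hg] at hD'
  have hD'0 : 0 < D' := Nat.pos_of_ne_zero (by rintro rfl; omega)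
  have hgL : g * L ∣ n := (mul_dvd_mul_right (Nat.gcd_dvd_right D t) L).trans htL
  have e1 : D * u / g = D' * u := by rw [hD', mul_assoc, Nat.mul_div_cancel_left _ hg0]
  have e2 : D * L = D' * (g * L) := by rw [hD']; ring
  rw [e1, e2, mul_left_comm k D' u, Nat.mul_dvd_mul_iff_left hD'0]
  exact ⟨fun h => (hcop.coprime_dvd_right hgL).symm.dvd_of_dvd_mul_right h,
    fun h => h.mul_right u⟩

/-- The hypothesis yields D(q^e-1) ∣ q^D-1. Writing both sides through geometric sums gives ev ∣ u,
while `u` is prime to `n` and hence to `e`. -/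
theorem eq_one_of_dvd_card_div_gcd {q n D t e : ℕ} (hq : 1 < q) (hD : 0 < D) (hDn : D ∣ n)
    (hqodd : Odd n → q ≡ 1 [MOD n]) (hqeven : Even n → q ≡ 1 [MOD 2 * n])
    (htq : t ∣ q - 1) (heD : e ∣ D)
    (h : D ∣ ((q ^ D - 1) / t) / Nat.gcd ((q ^ D - 1) / t) (q ^ e - 1)) : e = 1 := by
  have he : 0 < e := Nat.pos_of_dvd_of_pos heD hD
  obtain ⟨u, hu, hcop⟩ := exists_geom_sum_eq_mul hD hDn hqodd hqeven
  obtain ⟨v, hv, -⟩ := exists_geom_sum_eq_mul he (heD.trans hDn) hqodd hqeven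
  have hpow : ∀ k, q ^ k - 1 = (q - 1) * ∑ i ∈ range k, q ^ i := fun k => by
    rw [mul_comm, Nat.geomSum_eq hq, Nat.div_mul_cancel]
    simpa using Nat.sub_dvd_pow_sub_pow q 1 k
  have hteq : t ∣ q ^ e - 1 := htq.trans (by rw [hpow]; exact dvd_mul_right _ _)
  have hed : q ^ e - 1 ∣ q ^ D - 1 := Nat.pow_sub_one_dvd_pow_sub_one q heD
  have hN0 : 0 < q ^ D - 1 := Nat.sub_pos_of_lt (Nat.one_lt_pow hD.ne' hq)
  have he0 : 0 < q ^ e - 1 := Nat.sub_pos_of_lt (Nat.one_lt_pow he.ne' hq)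
  set N := (q ^ D - 1) / t with hN
  have hNt : t * N = q ^ D - 1 := Nat.mul_div_cancel' (hteq.trans hed)
  have h1 : q ^ e - 1 ∣ t * Nat.gcd N (q ^ e - 1) := by
    rw [← Nat.gcd_mul_left, hNt]
    exact Nat.dvd_gcd hed (dvd_mul_left _ _)
  have h2 : N / Nat.gcd N (q ^ e - 1) = (q ^ D - 1) / (t * Nat.gcd N (q ^ e - 1)) := by
    rw [hN, Nat.div_div_eq_div_mul]
  have h3 : t * Nat.gcd N (q ^ e - 1) ∣ q ^ D - 1 := by
    rw [← hNt]; exact mul_dvd_mul_left t (Nat.gcd_dvd_left _ _)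
  rw [h2] at h
  have h4 : D * (q ^ e - 1) ∣ q ^ D - 1 := by
    rw [← Nat.div_mul_cancel h3]
    exact mul_dvd_mul h h1
  rw [hpow D, hpow e, hu, hv, mul_left_comm,
    Nat.mul_dvd_mul_iff_left (by omega : 0 < q - 1), Nat.mul_dvd_mul_iff_left hD] at h4
  exact Nat.Coprime.eq_one_of_dvd (hcop.coprime_dvd_right (heD.trans hDn)).symm
    ((dvd_mul_right e v).trans h4)

/-! ### Character sums over subgroups of a cyclic group -/

-- The elements killed by `k` form the subgroup generated by `g ^ (N / gcd(N, k))`, where `N` is the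
-- group order; orthogonality of characters applies there.
open scoped Classical in
theorem sum_filter_pow_eq_one {G : Type*} [CommGroup G] [Fintype G] {g : G}
    (hg : ∀ x, x ∈ Subgroup.zpowers g) (ψ : G →* ℂˣ) (k : ℕ) :
    ∑ c : G with c ^ k = 1, ((ψ c : ℂˣ) : ℂ) =
      if ψ g ^ (Nat.card G / Nat.gcd (Nat.card G) k) = 1 then
        (Nat.gcd (Nat.card G) k : ℂ) else 0 := by
  have : IsCyclic G := ⟨g, hg⟩
  have hN : 0 < Nat.card G := Nat.card_pos
  have hord : orderOf g = Nat.card G := orderOf_eq_card_of_forall_mem_zpowers hg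
  set H : Subgroup G := (powMonoidHom k : G →* G).ker
  have hcard : Nat.card H = Nat.gcd (Nat.card G) k := IsCyclic.card_powMonoidHom_ker G k
  have h1 : ∑ c : G with c ^ k = 1, ((ψ c : ℂˣ) : ℂ) =
      ∑ c : H, ((Units.coeHom ℂ).comp (ψ.comp H.subtype)) c := by
    rw [Finset.sum_subtype (p := fun c => c ∈ H)]
    · rfl
    · intro x
      simp [H, MonoidHom.mem_ker]
  have h2 : (Units.coeHom ℂ).comp (ψ.comp H.subtype) = 1 ↔
      ψ g ^ (Nat.card G / Nat.gcd (Nat.card G) k) = 1 := by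
    have hdvd := Nat.gcd_dvd_left (Nat.card G) k
    constructor
    · intro h
      have hmem : g ^ (Nat.card G / Nat.gcd (Nat.card G) k) ∈ H := by
        rw [MonoidHom.mem_ker, powMonoidHom_apply, ← pow_mul, ← orderOf_dvd_iff_pow_eq_one, hord]
        obtain ⟨a, ha⟩ := Nat.gcd_dvd_right (Nat.card G) k
        refine ⟨a, ?_⟩
        nth_rewrite 2 [ha]
        rw [← mul_assoc, Nat.div_mul_cancel hdvd]
      have := DFunLike.congr_fun h ⟨_, hmem⟩
      simpa [← Units.val_pow_eq_pow_val] using this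
    · intro h
      ext ⟨c, hc⟩
      obtain ⟨j, rfl⟩ := (mem_powers_iff_mem_zpowers (x := g)).2 (hg c)
      simp only [H, MonoidHom.mem_ker, powMonoidHom_apply] at hc
      rw [← pow_mul, ← orderOf_dvd_iff_pow_eq_one, hord] at hc
      have hj : Nat.card G / Nat.gcd (Nat.card G) k ∣ j := by
        refine (Nat.coprime_div_gcd_div_gcd
          (Nat.gcd_pos_of_pos_left k hN)).dvd_of_dvd_mul_right
          (n := k / Nat.gcd (Nat.card G) k) ?_
        rw [← Nat.mul_div_assoc _ (Nat.gcd_dvd_right _ _)]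
        exact Nat.div_dvd_div hdvd hc
      obtain ⟨a, rfl⟩ := hj
      simp only [MonoidHom.comp_apply, Subgroup.subtype_apply, pow_mul, map_pow, h, one_pow,
        map_one, MonoidHom.one_apply]
  rw [h1, sum_hom_units, ← Nat.card_eq_fintype_card, hcard]
  simp only [h2]
  split_ifs <;> simp

/-! ### Frobenius orbits and degrees -/

namespace NewDegree

section

variable {G : Type*} [CommGroup G] [Finite G] {q : ℕ}

theorem pow_mem_periodicPts (hq : Nat.Coprime (Nat.card G) q) (c : G) :
    c ∈ Function.periodicPts (fun x : G => x ^ q) := by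
  have hinj : Function.Injective (fun x : G => x ^ q) := (powCoprime hq).injective
  exact Function.Injective.mem_periodicPts hinj c

theorem frobOrbit_eq_of_mem (hq : Nat.Coprime (Nat.card G) q) {c y : G}
    (h : y ∈ frobOrbit q c) : frobOrbit q y = frobOrbit q c := by
  have sub : ∀ {a b : G}, b ∈ frobOrbit q a → frobOrbit q b ⊆ frobOrbit q a := by
    rintro a _ ⟨i, rfl⟩ _ ⟨j, rfl⟩
    exact ⟨i + j, by simp [pow_add, pow_mul]⟩
  refine (sub h).antisymm (sub ?_)
  obtain ⟨i, rfl⟩ := h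
  obtain ⟨r, hr, hper⟩ := pow_mem_periodicPts hq c
  have hper' : ∀ j, c ^ q ^ (r * j) = c := by
    intro j
    have := hper.mul_const j
    rwa [Function.IsPeriodicPt, pow_iterate] at this
  -- Going on from step `i` to a multiple of the period `r` returns to `c`.
  refine ⟨r * i - i, ?_⟩
  simp only
  rw [← pow_mul, ← pow_add, Nat.add_sub_cancel' (Nat.le_mul_of_pos_left i hr), hper']

omit [Finite G] in
theorem mem_frobOrbit_self (c : G) : c ∈ frobOrbit q c := ⟨0, by simp⟩

theorem frobOrbit_eq_iff (hq : Nat.Coprime (Nat.card G) q) {c y : G} :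
    frobOrbit q y = frobOrbit q c ↔ y ∈ frobOrbit q c :=
  ⟨fun h => h ▸ mem_frobOrbit_self y, frobOrbit_eq_of_mem hq⟩

theorem frobDegree_eq_minimalPeriod (hq : Nat.Coprime (Nat.card G) q) (c : G) :
    frobDegree q c = Function.minimalPeriod (fun x : G => x ^ q) c := by
  have hmem := pow_mem_periodicPts hq c
  have h : frobOrbit q c = (fun i => (fun x : G => x ^ q)^[i] c) ''
      Set.Iio (Function.minimalPeriod (fun x : G => x ^ q) c) := by
    ext y
    constructor
    · rintro ⟨i, rfl⟩
      refine ⟨i % Function.minimalPeriod (fun x : G => x ^ q) c,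
        Nat.mod_lt _ (Function.minimalPeriod_pos_of_mem_periodicPts hmem), ?_⟩
      simp only [Function.iterate_mod_minimalPeriod_eq]
      rw [pow_iterate]
    · rintro ⟨i, -, rfl⟩
      exact ⟨i, by simp only [pow_iterate]⟩
  rw [frobDegree, h, Set.InjOn.ncard_image Function.iterate_injOn_Iio_minimalPeriod]
  simp

theorem frobDegree_dvd_iff (hq0 : 0 < q) (hq : Nat.Coprime (Nat.card G) q) (c : G) (e : ℕ) :
    frobDegree q c ∣ e ↔ c ^ (q ^ e - 1) = 1 := by
  rw [frobDegree_eq_minimalPeriod hq, ← Function.isPeriodicPt_iff_minimalPeriod_dvd,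
    Function.IsPeriodicPt, pow_iterate, Function.IsFixedPt]
  have h : q ^ e = (q ^ e - 1) + 1 := (Nat.sub_add_cancel (Nat.pow_pos hq0)).symm
  conv_lhs => rw [h]
  simp [pow_succ]

end

open scoped Classical ArithmeticFunction.Moebius in
theorem sum_frobDegree_eq {G R : Type*} [CommGroup G] [Fintype G] [Ring R] {q : ℕ} (hq0 : 0 < q)
    (hq : Nat.Coprime (Nat.card G) q) (f : G → R) {d : ℕ} (hd : 0 < d) :
    ∑ c : G with frobDegree q c = d, f c =
      ∑ x ∈ d.divisorsAntidiagonal, (ArithmeticFunction.moebius x.1 : R) *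
        ∑ c : G with c ^ (q ^ x.2 - 1) = 1, f c := by
  symm
  refine (ArithmeticFunction.sum_eq_iff_sum_mul_moebius_eq
    (f := fun e => ∑ c : G with frobDegree q c = e, f c)
    (g := fun e => ∑ c : G with c ^ (q ^ e - 1) = 1, f c)).1 ?_ d hd
  intro e he
  rw [Finset.sum_fiberwise_eq_sum_filter]
  refine Finset.sum_congr ?_ fun _ _ => rfl
  ext c
  simp [← frobDegree_dvd_iff hq0 hq, he.ne']

end NewDegree

/-! ### Characters of finite fields and their classes -/

namespace NewDegree

section CharGroup

variable (k : Type*) [Field k] [Finite k]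

theorem CharGroup.nonempty_mulEquiv : Nonempty (CharGroup k ≃* kˣ) :=
  have : NeZero (Monoid.exponent kˣ) := ⟨Monoid.exponent_ne_zero_of_finite⟩
  CommGroup.monoidHom_mulEquiv_of_hasEnoughRootsOfUnity kˣ ℂ

theorem CharGroup.isCyclic : IsCyclic (CharGroup k) :=
  have ⟨e⟩ := CharGroup.nonempty_mulEquiv k
  isCyclic_of_surjective e.symm e.symm.surjective

theorem CharGroup.card : Nat.card (CharGroup k) = Nat.card k - 1 := by
  have ⟨e⟩ := CharGroup.nonempty_mulEquiv k
  rw [Nat.card_congr e.toEquiv, Nat.card_units]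

variable {k}

theorem CharGroup.eq_one_of_forall_apply_eq_one {x : kˣ} (h : ∀ α : CharGroup k, α x = 1) :
    x = 1 := by
  have : NeZero (Monoid.exponent kˣ) := ⟨Monoid.exponent_ne_zero_of_finite⟩
  by_contra hx
  obtain ⟨φ, hφ⟩ := CommGroup.exists_apply_ne_one_of_hasEnoughRootsOfUnity kˣ ℂ hx
  exact hφ (h φ)

/-- Characters separate points, and every character is a power of `ω`, so `ω` alone is faithful. -/
theorem CharGroup.orderOf_apply_generator {ω : CharGroup k}
    (hω : ∀ α, α ∈ Subgroup.zpowers ω) (x : kˣ) : orderOf (ω x) = orderOf x := by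
  refine Nat.dvd_antisymm ?_ ?_
  · rw [orderOf_dvd_iff_pow_eq_one, ← map_pow, pow_orderOf_eq_one, map_one]
  · rw [orderOf_dvd_iff_pow_eq_one]
    refine CharGroup.eq_one_of_forall_apply_eq_one fun α => ?_
    obtain ⟨j, rfl⟩ := hω α
    change CharGroup.eval _ (ω ^ j) = 1
    rw [map_zpow]
    change ω _ ^ j = 1
    rw [map_pow, pow_orderOf_eq_one, one_zpow]

end CharGroup

section

variable {F K : Type*} [Field F] [Finite F] [Field K] [Finite K] [Algebra F K]

omit [Finite F] in
theorem normTranspose_injective : Function.Injective (normTranspose F K) := by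
  intro α β h
  refine DFunLike.ext _ _ fun y => ?_
  obtain ⟨x, rfl⟩ := FiniteField.unitsMap_norm_surjective F K y
  exact DFunLike.congr_fun (F := Kˣ →* ℂˣ) h x

theorem card_charClass {δ : CharGroup F} (hδ : ∀ β : CharGroup F, β ∈ Subgroup.zpowers δ)
    {t : ℕ} (ht : t ∣ Nat.card F - 1) :
    Nat.card (CharClass K δ t) = (Nat.card F ^ Module.finrank F K - 1) / t := by
  have hq : 0 < Nat.card F - 1 := Nat.sub_pos_of_lt Finite.one_lt_card
  have ht0 : 0 < t := Nat.pos_of_dvd_of_pos ht hq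
  have hδo : orderOf δ = Nat.card F - 1 := by
    rw [orderOf_eq_card_of_forall_mem_zpowers hδ, CharGroup.card]
  have hcard : Nat.card (Subgroup.zpowers (normTranspose F K (δ ^ ((Nat.card F - 1) / t)))) = t := by
    -- Surjectivity of the norm makes its transpose injective, so δ keeps its order q - 1 in the
    -- larger group.
    rw [Nat.card_zpowers, orderOf_injective _ normTranspose_injective,
      orderOf_pow_of_dvd (Nat.div_pos (Nat.le_of_dvd hq ht) ht0).ne'
        (hδo.symm ▸ Nat.div_dvd_of_dvd ht), hδo, Nat.div_div_self ht hq.ne']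
  have h := Subgroup.card_eq_card_quotient_mul_card_subgroup
    (Subgroup.zpowers (normTranspose F K (δ ^ ((Nat.card F - 1) / t))))
  rw [hcard, CharGroup.card, Module.natCard_eq_pow_finrank (K := F) (V := K)] at h
  rw [h, Nat.mul_div_cancel _ ht0]

theorem exists_charClass_generator (δ : CharGroup F) {ζ : Fˣ} {n D t dhat : ℕ}
    (hζ : orderOf ζ = n) (hD : Module.finrank F K = D) (ht : t ∣ n) (hDt : D ∣ t * dhat)
    (htd : t * dhat ∣ n) :
    ∃ g : CharClass K δ t, (∀ x, x ∈ Subgroup.zpowers g) ∧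
      orderOf (evalClass δ hζ hD ht hDt g) = n / (t * dhat / D) := by
  obtain ⟨ω, hω⟩ := (CharGroup.isCyclic K).exists_generator
  refine ⟨QuotientGroup.mk ω, fun x => ?_, ?_⟩
  · obtain ⟨α, rfl⟩ := QuotientGroup.mk_surjective x
    obtain ⟨j, rfl⟩ := hω α
    exact ⟨j, rfl⟩
  · have hn : 0 < n := hζ ▸ orderOf_pos ζ
    have hz : orderOf (Units.map (algebraMap F K : F →* K) ζ) = n := by
      rw [← hζ]
      exact orderOf_injective _ (Units.map_injective (algebraMap F K).injective) ζ
    rw [evalClass_mk, CharGroup.orderOf_apply_generator hω, evalPoint, hD,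
      orderOf_pow_of_dvd _ _, hz]
    · exact (Nat.div_pos (Nat.le_of_dvd (Nat.pos_of_dvd_of_pos htd hn) hDt)
        (Nat.pos_of_dvd_of_pos hDt (Nat.pos_of_dvd_of_pos htd hn))).ne'
    · rw [hz]
      exact (Nat.div_dvd_of_dvd hDt).trans htd

-- The evaluation point comes from `F`, so raising it to the power q changes nothing.
omit [Finite K] in
theorem evalClass_pow_card {δ : CharGroup F} {ζ : Fˣ} {n D t dhat : ℕ}
    (hζ : orderOf ζ = n) (hD : Module.finrank F K = D) (ht : t ∣ n) (hDt : D ∣ t * dhat)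
    (c : CharClass K δ t) (i : ℕ) :
    evalClass δ hζ hD ht hDt (c ^ Nat.card F ^ i) = evalClass δ hζ hD ht hDt c := by
  obtain ⟨α, rfl⟩ := QuotientGroup.mk_surjective c
  have h1 : ζ ^ Nat.card F ^ i = ζ := by
    ext
    have := Fintype.ofFinite F
    rw [Units.val_pow_eq_pow_val, Nat.card_eq_fintype_card, FiniteField.pow_card_pow]
  have h : evalPoint K ζ t dhat ^ Nat.card F ^ i = evalPoint K ζ t dhat := by
    rw [evalPoint, pow_right_comm, ← map_pow, h1]
  rw [map_pow, evalClass_mk, ← map_pow, h]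

omit [Finite K] in
theorem evalClass_eq_of_mem_frobOrbit {δ : CharGroup F} {ζ : Fˣ} {n D t dhat : ℕ}
    (hζ : orderOf ζ = n) (hD : Module.finrank F K = D) (ht : t ∣ n) (hDt : D ∣ t * dhat)
    {c y : CharClass K δ t} (h : y ∈ frobOrbit (Nat.card F) c) :
    evalClass δ hζ hD ht hDt y = evalClass δ hζ hD ht hDt c := by
  obtain ⟨i, rfl⟩ := h
  exact evalClass_pow_card hζ hD ht hDt c i

end

/-! ### Power sums over a fixed degree -/

open scoped Classical in
theorem card_filter_frobOrbit_eq {G : Type*} [CommGroup G] [Fintype G] {q d : ℕ}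
    (hq : Nat.Coprime (Nat.card G) q) {c : G} (hc : frobDegree q c = d) :
    #{y ∈ ({y : G | frobDegree q y = d} : Finset G) | frobOrbit q y = frobOrbit q c} = d := by
  rw [← hc, frobDegree, ← Set.ncard_coe_finset]
  congr 1
  ext y
  simp only [coe_filter, mem_filter, mem_univ, true_and, Set.mem_ofPred_eq, ← frobOrbit_eq_iff hq]
  exact ⟨fun h => h.2, fun h => ⟨by rw [frobDegree, h], h⟩⟩

open scoped Classical in
/-- The power sums of a character `χ` over the elements of a given degree. -/
theorem sum_frobDegree_pow {G : Type*} [CommGroup G] [Fintype G] {g : G}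
    (hg : ∀ x, x ∈ Subgroup.zpowers g) (χ : G →* ℂˣ) {q n D t d L k : ℕ} (hq : 1 < q)
    (hcop : Nat.Coprime (Nat.card G) q) (hG : Nat.card G = (q ^ D - 1) / t)
    (hχ : orderOf (χ g) = D * L) (hDn : D ∣ n)
    (hqodd : Odd n → q ≡ 1 [MOD n]) (hqeven : Even n → q ≡ 1 [MOD 2 * n])
    (htq : t ∣ q - 1) (htn : t ∣ n) (hDt : D ∣ t * d) (hdD : d ∣ D) (hn : n = d * t * L)
    (hn0 : 0 < n) (hk : 0 < k) (hkL : k ≤ L) :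
    ∑ c : G with frobDegree q c = d, ((χ c : ℂˣ) : ℂ) ^ k =
      if k = L ∧ Nat.gcd D t = 1 then
        (ArithmeticFunction.moebius d : ℂ) * (((q : ℂ) - 1) / (t : ℂ)) else 0 := by
  have hD : 0 < D := Nat.pos_of_dvd_of_pos hDn hn0
  have hd : 0 < d := Nat.pos_of_dvd_of_pos hdD hD
  have ht : 0 < t := Nat.pos_of_dvd_of_pos htn hn0
  have hL : 0 < L := hk.trans_le hkL
  have htL : t * L ∣ n := ⟨d, by rw [hn]; ring⟩
  obtain ⟨hgcd, hiff⟩ := dvd_card_div_gcd_sub_one_iff (k := k) (L := L) hq hD hDn hqodd hqeven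
    htq htL ht htn
  have hsum : ∀ e, ∑ c : G with c ^ (q ^ e - 1) = 1, ((χ c : ℂˣ) : ℂ) ^ k =
      if D * L ∣ k * (Nat.card G / Nat.gcd (Nat.card G) (q ^ e - 1)) then
        (Nat.gcd (Nat.card G) (q ^ e - 1) : ℂ) else 0 := by
    intro e
    have h := sum_filter_pow_eq_one hg (χ ^ k) (q ^ e - 1)
    simp only [MonoidHom.pow_apply, Units.val_pow_eq_pow_val, ← pow_mul] at h
    rw [h]
    simp only [← orderOf_dvd_iff_pow_eq_one, hχ]
  rw [sum_frobDegree_eq (by omega) hcop _ hd]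
  split_ifs with h
  · obtain ⟨rfl, h1⟩ := h
    have hdD' : d = D := Nat.dvd_antisymm hdD (Nat.Coprime.dvd_of_dvd_mul_left h1 hDt)
    subst hdD'
    rw [Finset.sum_eq_single (d, 1)]
    · rw [hsum, pow_one, hG, if_pos (hiff.2 (by rw [h1, one_mul])), hgcd, h1, mul_one,
        Nat.cast_div htq (Nat.cast_ne_zero.2 ht.ne'), Nat.cast_sub hq.le, Nat.cast_one]
    · rintro ⟨a, e⟩ hx hne
      rw [Nat.mem_divisorsAntidiagonal] at hx
      simp only at hx ⊢
      rw [hsum, if_neg, mul_zero]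
      intro hdvd
      rw [mul_comm d, Nat.mul_dvd_mul_iff_left hL, hG] at hdvd
      have he := eq_one_of_dvd_card_div_gcd hq hD hDn hqodd hqeven htq ⟨a, by
        rw [← hx.1, mul_comm]⟩ hdvd
      subst he
      exact hne (by rw [← hx.1, mul_one])
    · intro h
      exact absurd (Nat.mem_divisorsAntidiagonal.2 ⟨mul_one d, hd.ne'⟩) h
  · refine Finset.sum_eq_zero fun x _ => ?_
    rw [hsum, if_neg, mul_zero]
    intro hdvd
    have hm : ∀ e, q - 1 ∣ q ^ e - 1 := fun e => by
      simpa using Nat.sub_dvd_pow_sub_pow q 1 e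
    -- The case e = 1 is the weakest: gcd(N, q-1) divides gcd(N, q^e-1), so divisibility for any `e`
    -- implies it for 1.
    have hdvd1 : D * L ∣ k * (Nat.card G / Nat.gcd (Nat.card G) (q - 1)) :=
      hdvd.trans (mul_dvd_mul_left k (Nat.div_dvd_div_left
        (Nat.gcd_dvd_left _ _) (Nat.gcd_dvd_gcd_of_dvd_right _ (hm x.2))))
    rw [hG, hiff] at hdvd1
    have hle := Nat.le_of_dvd hk hdvd1
    have hg0 : 0 < Nat.gcd D t := Nat.gcd_pos_of_pos_left _ hD
    have hg1 : Nat.gcd D t = 1 := by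
      have : Nat.gcd D t * L ≤ 1 * L := by omega
      have := Nat.le_of_mul_le_mul_right this hL
      omega
    rw [hg1, one_mul] at hle
    exact h ⟨le_antisymm hkL hle, hg1⟩

end NewDegree

end

/-! ### Assembly -/

theorem lemmal {F K : Type*} [Field F] [Finite F] [Field K] [Finite K] [Algebra F K]
    (q n D t dhat m : ℕ) (lam : Fin m → ℕ)
    (hF : Nat.card F = q) (hD : Module.finrank F K = D)
    (δ : NewDegree.CharGroup F) (hδ : ∀ β : NewDegree.CharGroup F, β ∈ Subgroup.zpowers δ)
    (ζ : Fˣ) (hζ : orderOf ζ = n)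
    (hqodd : Odd n → q ≡ 1 [MOD n]) (hqeven : Even n → q ≡ 1 [MOD 2 * n])
    (hDn : D ∣ n) (hdn : dhat ∣ n) (ht : t ∣ n)
    (hDt : D ∣ t * dhat) (hdD : dhat ∣ D)
    (hlam : ∀ i, 0 < lam i) (hn : n = dhat * t * ∑ i, lam i) :
    NewDegree.Zhat δ hζ hD ht hDt lam =
      if Nat.gcd D t = 1 then
        (ArithmeticFunction.moebius dhat : ℂ) * (-(dhat : ℂ)) ^ (m - 1) *
          (Nat.factorial (m - 1) : ℂ) * (((q : ℂ) - 1) / (t : ℂ))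
      else 0 := by
  classical
  subst hF
  have hn0 : 0 < n := hζ ▸ orderOf_pos ζ
  have hD0 : 0 < D := Nat.pos_of_dvd_of_pos hDn hn0
  have ht0 : 0 < t := Nat.pos_of_dvd_of_pos ht hn0
  have hd0 : 0 < dhat := Nat.pos_of_dvd_of_pos hdn hn0
  have hq : 1 < Nat.card F := Finite.one_lt_card
  -- An empty tuple would give n = 0, so `m - 1` never truncates.
  obtain ⟨m, rfl⟩ : ∃ m', m = m' + 1 := by
    rcases m with _ | m
    · simp at hn
      omega
    · exact ⟨m, rfl⟩
  have htq : t ∣ Nat.card F - 1 := by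
    rw [← Nat.card_units]
    exact ht.trans (hζ ▸ orderOf_dvd_natCard ζ)
  set L := ∑ i, lam i with hL
  have htd : t * dhat ∣ n := ⟨L, by rw [hn]; ring⟩
  let _ : Fintype (NewDegree.CharClass K δ t) := Fintype.ofFinite _
  have hG : Nat.card (NewDegree.CharClass K δ t) = (Nat.card F ^ D - 1) / t := by
    rw [NewDegree.card_charClass hδ htq, hD]
  have hcop : Nat.Coprime (Nat.card (NewDegree.CharClass K δ t)) (Nat.card F) := by
    have h1 : Nat.card (NewDegree.CharClass K δ t) ∣ Nat.card F ^ D - 1 := by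
      rw [hG]
      exact Nat.div_dvd_of_dvd (htq.trans (by simpa using Nat.sub_dvd_pow_sub_pow _ 1 D))
    refine Nat.Coprime.coprime_dvd_left h1 ?_
    refine Nat.Coprime.coprime_dvd_right (dvd_pow_self _ hD0.ne') ?_
    rw [Nat.coprime_comm]
    exact (Nat.coprime_self_sub_right (Nat.one_le_pow _ _ (by omega))).2 (Nat.coprime_one_right _)
  obtain ⟨g, hg, hord⟩ := NewDegree.exists_charClass_generator (K := K) δ hζ hD ht hDt htd
  have hord' : orderOf (NewDegree.evalClass δ hζ hD ht hDt g) = D * L := by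
    rw [hord]
    obtain ⟨a, ha⟩ := hDt
    rw [ha, Nat.mul_div_cancel_left _ hD0]
    have ha0 : 0 < a := Nat.pos_of_ne_zero (by rintro rfl; have := Nat.mul_pos ht0 hd0; omega)
    refine Nat.div_eq_of_eq_mul_left ha0 ?_
    rw [hn, mul_comm dhat t, ha]
    ring
  have hsum := fun (k : ℕ) (hk : 0 < k) (hkL : k ≤ L) =>
    NewDegree.sum_frobDegree_pow hg (NewDegree.evalClass δ hζ hD ht hDt) hq hcop hG hord' hDn hqodd
      hqeven htq ht hDt hdD hn hn0 hk hkL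
  have hL0 : 0 < L := Nat.pos_of_ne_zero (by intro h; rw [h] at hn; omega)
  have hZ : NewDegree.Zhat δ hζ hD ht hDt lam =
      distinctFiberSum (NewDegree.frobOrbit (Nat.card F))
        {c : NewDegree.CharClass K δ t | NewDegree.frobDegree (Nat.card F) c = dhat}
        (fun c => ((NewDegree.evalClass δ hζ hD ht hDt c : ℂˣ) : ℂ)) lam := by
    rw [NewDegree.Zhat, distinctFiberSum]
    refine Finset.sum_congr ?_ fun _ _ => rfl
    ext c
    simp only [DistinctFibers, Finset.mem_filter, Finset.mem_univ, true_and]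
  rw [hZ, distinctFiberSum_eq_of_powerSum_eq_zero (d := dhat) _ _ _ hlam, ← hL, hsum L hL0 le_rfl]
  · simp only [true_and, Nat.add_sub_cancel]
    split_ifs
    · ring
    · simp
  · intro k hk hkL
    rw [← hL] at hkL
    rw [hsum k hk hkL.le, if_neg (fun h => hkL.ne h.1)]
  · intro c hc
    exact NewDegree.card_filter_frobOrbit_eq hcop (Finset.mem_filter.1 hc).2
  · intro x _ y _ hxy
    rw [NewDegree.evalClass_eq_of_mem_frobOrbit hζ hD ht hDt
      ((NewDegree.frobOrbit_eq_iff hcop).1 hxy)]
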